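/- A (4,5,6)-fullerene is a connected simple plane graph in which every vertex has degree $3$ and every face (including the outer face) is bounded by a cycle of length $4$, $5$ or $6$. A graph $G$ is $2$-extendable if it is connected, has at least $6$ vertices, has a matching of size $2$, and every matching of size $2$ in $G$ is contained in a perfect matching of $G$. Then for every even integer $n \ge 10$ there exists a (4,5,6)-fullerene with exactly $n$ vertices that is not $2$-extendable. -/

import Mathlib

namespace Fullerene

/-- For a permutation `rot` of the darts of `G` that maps each dart to the next one in the
counterclockwise order around its initial vertex, this permutation maps each dart to the next one
on the boundary walk of the face lying on a fixed side of it (turn around at the end of the dart,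
then rotate). Its cycles are the faces. -/
def facePerm {V : Type*} {G : SimpleGraph V} (rot : Equiv.Perm G.Dart) : Equiv.Perm G.Dart :=
  (Function.Involutive.toPerm SimpleGraph.Dart.symm SimpleGraph.Dart.symm_involutive).trans rot

theorem facePerm_apply {V : Type*} {G : SimpleGraph V} (rot : Equiv.Perm G.Dart) (d : G.Dart) :
    facePerm rot d = rot d.symm := rfl

/-- The set of faces: the cycles (orbits) of the face permutation. -/
def Face {V : Type*} {G : SimpleGraph V} (rot : Equiv.Perm G.Dart) : Type _ :=
  Quotient (Equiv.Perm.SameCycle.setoid (facePerm rot))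

/-- An embedding of a finite connected simple graph `G` (with at least one edge) in the sphere,
i.e. a plane graph, up to homeomorphism: a rotation system (for every vertex `v`, a cyclic order of
the darts leaving `v`, the order in which they leave `v` counterclockwise) of genus `0`, that is,
one which satisfies Euler's formula `|V| - |E| + |F| = 2`. -/
structure PlaneEmbedding {V : Type*} (G : SimpleGraph V) where
  connected : G.Connected
  /-- `rot d` is the dart that follows `d` in the cyclic order around the initial vertex of `d`. -/
  rot : Equiv.Perm G.Dart
  rot_fst : ∀ d : G.Dart, (rot d).fst = d.fst
  /-- The darts leaving one vertex form a single cycle of `rot`. -/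
  rot_sameCycle : ∀ d e : G.Dart, d.fst = e.fst → rot.SameCycle d e
  /-- The surface is the sphere (`|V| + |F| = |E| + 2`). -/
  euler : Nat.card V + Nat.card (Face rot) = Nat.card G.edgeSet + 2

/-- The face whose boundary walk traverses the dart `d` is a `k`-gon: its boundary walk closes up
after exactly `k` steps, and it is a cycle of `G`, i.e. the `k` vertices on it are distinct. -/
def PlaneEmbedding.FaceIsGon {V : Type*} {G : SimpleGraph V} (P : PlaneEmbedding G)
    (d : G.Dart) (k : ℕ) : Prop :=
  Function.minimalPeriod (facePerm P.rot) d = k ∧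
    Set.InjOn (fun i : ℕ => ((facePerm P.rot)^[i] d).fst) (Set.Iio k)

/-- A (4,5,6)-fullerene: a plane cubic graph all of whose faces are quadrilaterals, pentagons or
hexagons (each dart lies on the boundary walk of exactly one face, and each face has a dart). -/
def Is456Fullerene {V : Type*} (G : SimpleGraph V) : Prop :=
  (∀ v : V, (G.neighborSet v).ncard = 3) ∧
    ∃ P : PlaneEmbedding G,
      ∀ d : G.Dart, P.FaceIsGon d 4 ∨ P.FaceIsGon d 5 ∨ P.FaceIsGon d 6

/-- A finite graph is `k`-extendable if it is connected, has at least `2k + 2` vertices, has a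
matching of size `k`, and each matching of size `k` is contained in a perfect matching. -/
def IsExtendable {V : Type*} (G : SimpleGraph V) (k : ℕ) : Prop :=
  G.Connected ∧ 2 * k + 2 ≤ Nat.card V ∧
    (∃ M : G.Subgraph, M.IsMatching ∧ M.edgeSet.ncard = k) ∧
    ∀ M : G.Subgraph, M.IsMatching → M.edgeSet.ncard = k →
      ∃ N : G.Subgraph, N.IsPerfectMatching ∧ M ≤ N

end Fullerene

/-!
For each even `n ≥ 10` the graph is a capped hexagonal tube wound along a Hamiltonian path
`0, 1, …, n - 1`. In the body of the tube each even vertex `i` is joined to `i + 7`, so that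
`i, i + 1, i + 2, i + 9, i + 8, i + 7` bounds a hexagon. One end is closed by the edges `{0, 3}`,
`{0, 5}` and `{1, 7}`, which create two quadrilaterals and two pentagons, and the other end by the
images of these edges under `v ↦ n - 1 - v`. For `n = 10` the tube is the pentagonal prism.

All edges join vertices of different parity, except `{1, 7}` and `{n - 8, n - 2}`. A perfect matching
uses equally many odd-odd and even-even edges, so one that contains `{1, 7}` contains
`{n - 8, n - 2}`, and cannot contain `{n - 2, n - 1}`. Therefore the matching
`{1, 7}, {n - 2, n - 1}` does not extend (`no_perfect_pairing`, `not_isExtendable_tube`).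

Planarity is Euler's formula. There are `3 * n / 2` edges, so `n / 2 + 2` faces are needed.
The faces are listed by their boundary cycles, each with one representing dart
(`exists_isFaceWalk`). No face contains two representatives, and every dart is reached from a
representative by following face boundaries (`dart_induction`); this gives the number of faces
(`card_face`), and their lengths.
-/

namespace Fullerene

/-! ### Cubic graphs given by a rotation system -/

/-- The combinatorial data of a cubic simple graph embedded in an oriented surface: every vertex `v`
has three distinct neighbours `nb v 0`, `nb v 1`, `nb v 2`, listed in their cyclic order around `v`. -/
structure CubicRotation (V : Type*) where
  nb : V → Fin 3 → V
  inj : ∀ v, Function.Injective (nb v)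
  ne : ∀ v i, nb v i ≠ v
  symm : ∀ v i, ∃ j, nb (nb v i) j = v

namespace CubicRotation

variable {V : Type*} (R : CubicRotation V)

/-- The underlying simple graph. -/
def graph : SimpleGraph V where
  Adj u v := ∃ i, R.nb u i = v
  symm := ⟨by
    rintro u v ⟨i, rfl⟩
    exact R.symm u i⟩
  loopless := ⟨fun v ⟨i, hi⟩ => R.ne v i hi⟩

theorem adj_nb (v : V) (i : Fin 3) : R.graph.Adj v (R.nb v i) := ⟨i, rfl⟩

theorem ncard_neighborSet (v : V) : (R.graph.neighborSet v).ncard = 3 := by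
  have h : R.graph.neighborSet v = Set.range (R.nb v) := rfl
  rw [h, ← Nat.card_coe_set_eq, Nat.card_range_of_injective (R.inj v), Nat.card_fin]

theorem two_mul_card_edgeSet [Finite V] :
    2 * Nat.card R.graph.edgeSet = 3 * Nat.card V := by
  classical
  have := Fintype.ofFinite V
  have h := R.graph.sum_degrees_eq_twice_card_edges
  have hd (v : V) : R.graph.degree v = 3 := by
    rw [← R.ncard_neighborSet v, ← Nat.card_coe_set_eq, Nat.card_eq_fintype_card,
      SimpleGraph.card_neighborSet_eq_degree]
  rw [Nat.card_eq_fintype_card, Nat.card_eq_fintype_card, ← SimpleGraph.edgeFinset_card, ← h]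
  simp [hd, mul_comm]

/-- The position of the end of the dart `d` in the list of neighbours of its initial vertex. -/
noncomputable def slot (d : R.graph.Dart) : Fin 3 := d.adj.choose

theorem nb_slot (d : R.graph.Dart) : R.nb d.fst (R.slot d) = d.snd := d.adj.choose_spec

theorem slot_eq {d : R.graph.Dart} {v : V} {i : Fin 3} (h₁ : d.fst = v) (h₂ : R.nb v i = d.snd) :
    R.slot d = i := by
  subst h₁
  exact R.inj _ ((R.nb_slot d).trans h₂.symm)

/-- Rotation of a dart about its initial vertex by `k` positions. -/
noncomputable def turn (k : Fin 3) (d : R.graph.Dart) : R.graph.Dart :=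
  ⟨(d.fst, R.nb d.fst (R.slot d + k)), R.adj_nb _ _⟩

theorem turn_turn (k l : Fin 3) (d : R.graph.Dart) : R.turn k (R.turn l d) = R.turn (l + k) d := by
  have h : R.slot (R.turn l d) = R.slot d + l := R.slot_eq rfl rfl
  have h' : R.turn k (R.turn l d) = ⟨(d.fst, R.nb d.fst (R.slot (R.turn l d) + k)), R.adj_nb _ _⟩ :=
    rfl
  rw [h']
  simp only [h, add_assoc]
  rfl

theorem turn_zero (d : R.graph.Dart) : R.turn 0 d = d := by
  ext
  · rfl
  · simp [turn, R.nb_slot]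

/-- The rotation system: each dart is moved to the next position around its initial vertex. -/
noncomputable def rot : Equiv.Perm R.graph.Dart where
  toFun := R.turn 1
  invFun := R.turn 2
  left_inv d := by rw [turn_turn]; exact R.turn_zero d
  right_inv d := by rw [turn_turn]; exact R.turn_zero d

theorem rot_sameCycle (d e : R.graph.Dart) (h : d.fst = e.fst) : R.rot.SameCycle d e := by
  have key : ∀ k : Fin 3, R.rot.SameCycle d (R.turn k d) := by
    have h1 : R.rot.SameCycle d (R.turn 1 d) := Equiv.Perm.sameCycle_apply_right.2 (.refl _ _)
    intro k
    fin_cases k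
    · exact (R.turn_zero d).symm ▸ .refl _ _
    · exact h1
    · have h2 : R.turn 2 d = R.rot (R.turn 1 d) := (R.turn_turn 1 1 d).symm
      exact h2 ▸ Equiv.Perm.sameCycle_apply_right.2 h1
  have he : R.turn (R.slot e - R.slot d) d = e := by
    ext
    · exact h
    · simp [turn, h, R.nb_slot]
  exact he ▸ key _

/-- `Turns u v w`: at `v`, the neighbour `w` comes directly after `u`. Equivalently, the boundary walk
of a face that enters `v` from `u` leaves it towards `w`. -/
def Turns (u v w : V) : Prop := ∃ i, R.nb v i = u ∧ R.nb v (i + 1) = w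

theorem facePerm_of_turns {d : R.graph.Dart} {w : V} (h : R.Turns d.fst d.snd w) :
    (facePerm R.rot d).fst = d.snd ∧ (facePerm R.rot d).snd = w := by
  obtain ⟨i, hi, rfl⟩ := h
  have hs : R.slot d.symm = i := R.slot_eq rfl hi
  refine ⟨rfl, ?_⟩
  rw [← hs]
  rfl

/-- A closed sequence of vertices, each consecutive triple of which is a turn, is followed by the
boundary walk of the face of its first dart. -/
theorem iterate_facePerm {k : ℕ} [NeZero k] {w : Fin k → V}
    (hT : ∀ i, R.Turns (w i) (w (i + 1)) (w (i + 2))) {d : R.graph.Dart}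
    (h₀ : d.fst = w 0) (h₁ : d.snd = w 1) (m : ℕ) :
    ((facePerm R.rot)^[m] d).fst = w (Fin.ofNat k m) ∧
      ((facePerm R.rot)^[m] d).snd = w (Fin.ofNat k m + 1) := by
  have hsucc (m : ℕ) : Fin.ofNat k (m + 1) = Fin.ofNat k m + 1 := by
    ext; simp [Fin.val_add]
  induction m with
  | zero =>
    simp [h₀, h₁]
  | succ m ih =>
    rw [Function.iterate_succ_apply']
    have h := hT (Fin.ofNat k m)
    rw [← ih.1, ← ih.2] at h
    obtain ⟨h2, h3⟩ := R.facePerm_of_turns h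
    rw [hsucc, h2, h3, ih.2]
    refine ⟨rfl, ?_⟩
    rw [add_assoc]
    congr 2
    ext
    simp [Fin.val_add]

/-- If moreover the vertices of the closed sequence are distinct, the face is a `k`-gon. -/
theorem facePerm_gon {k : ℕ} [NeZero k] {w : Fin k → V} (hw : Function.Injective w)
    (hT : ∀ i, R.Turns (w i) (w (i + 1)) (w (i + 2))) {d : R.graph.Dart}
    (h₀ : d.fst = w 0) (h₁ : d.snd = w 1) :
    Function.minimalPeriod (facePerm R.rot) d = k ∧
      Set.InjOn (fun i : ℕ => ((facePerm R.rot)^[i] d).fst) (Set.Iio k) := by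
  have it := R.iterate_facePerm hT h₀ h₁
  refine ⟨Nat.dvd_antisymm ?_ ?_, ?_⟩
  · rw [← Function.isPeriodicPt_iff_minimalPeriod_dvd]
    have h := it k
    have hk : Fin.ofNat k k = 0 := by ext; simp
    rw [hk, zero_add, ← h₀, ← h₁] at h
    exact SimpleGraph.Dart.ext _ _ (Prod.ext h.1 h.2)
  · have h := (it (Function.minimalPeriod (facePerm R.rot) d)).1
    rw [Function.iterate_minimalPeriod, h₀] at h
    have := congrArg Fin.val (hw h)
    exact Nat.dvd_of_mod_eq_zero (by simpa using this.symm)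
  · intro i hi j hj hij
    have := congrArg Fin.val (hw ((it i).1.symm.trans (hij.trans (it j).1)))
    simpa [Nat.mod_eq_of_lt (Set.mem_Iio.1 hi), Nat.mod_eq_of_lt (Set.mem_Iio.1 hj)] using this

/-- The darts on the face of the first dart of a closed walk all belong to the walk. -/
theorem exists_of_sameCycle [Finite V] {k : ℕ} [NeZero k] {w : Fin k → V}
    (hT : ∀ i, R.Turns (w i) (w (i + 1)) (w (i + 2))) {d e : R.graph.Dart}
    (h₀ : d.fst = w 0) (h₁ : d.snd = w 1) (h : (facePerm R.rot).SameCycle d e) :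
    ∃ i, e.fst = w i ∧ e.snd = w (i + 1) := by
  classical
  have := Fintype.ofFinite V
  obtain ⟨m, -, hm⟩ := h.exists_pow_eq'
  have := R.iterate_facePerm hT h₀ h₁ m
  rw [Equiv.Perm.iterate_eq_pow, hm] at this
  exact ⟨_, this⟩

end CubicRotation

theorem PlaneEmbedding.FaceIsGon.of_apply {V : Type*} {G : SimpleGraph V} {P : PlaneEmbedding G}
    {d : G.Dart} {k : ℕ} (hk : 0 < k) (h : P.FaceIsGon d k) :
    P.FaceIsGon (facePerm P.rot d) k := by
  obtain ⟨hp, hi⟩ := h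
  have hper : d ∈ Function.periodicPts (facePerm P.rot) :=
    Function.minimalPeriod_pos_iff_mem_periodicPts.1 (hp ▸ hk)
  have hmod (m : ℕ) : (facePerm P.rot)^[m % k] d = (facePerm P.rot)^[m] d := by
    rw [← hp]; exact Function.iterate_mod_minimalPeriod_eq
  refine ⟨(Function.minimalPeriod_apply hper).trans hp, fun i hik j hjk hij => ?_⟩
  simp only [← Function.iterate_succ_apply] at hij
  rw [← hmod (i + 1), ← hmod (j + 1)] at hij
  have h : (i + 1) % k = (j + 1) % k := hi (Nat.mod_lt _ hk) (Nat.mod_lt _ hk) hij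
  have h' : i ≡ j [MOD k] := Nat.ModEq.add_right_cancel' 1 h
  exact h'.eq_of_lt_of_lt hik hjk

theorem PlaneEmbedding.FaceIsGon.of_sameCycle {V : Type*} [Finite V] {G : SimpleGraph V}
    {P : PlaneEmbedding G} {d e : G.Dart} {k : ℕ} (hk : 0 < k) (h : P.FaceIsGon d k)
    (hde : (facePerm P.rot).SameCycle d e) : P.FaceIsGon e k := by
  classical
  have := Fintype.ofFinite V
  obtain ⟨m, -, rfl⟩ := hde.exists_pow_eq'
  clear hde
  induction m with
  | zero => exact h
  | succ m ih => rw [pow_succ', Equiv.Perm.mul_apply]; exact ih.of_apply hk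

/-! ### The vertices, edges and rotation of the tube -/

variable {n : ℕ}

/-- The neighbour of `v` that precedes it on the Hamiltonian path `0, 1, …, n - 1`; the initial vertex
`0` has no predecessor, and its edge to `3` takes this role. -/
def prv (v : ℕ) : ℕ := if v = 0 then 3 else v - 1

/-- The neighbour of `v` that follows it on the Hamiltonian path; for the last vertex `n - 1`, the edge
to `n - 4` takes this role. -/
def nxt (n v : ℕ) : ℕ := if v = n - 1 then n - 4 else v + 1

/-- The third neighbour of `v`. In the middle of the tube, even vertices are joined to the vertex seven
steps later on the path; the other cases close the two ends. The half-turn `v ↦ n - 1 - v`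
interchanges the two parity branches. -/
def chord (n v : ℕ) : ℕ :=
  if v % 2 = 0 then
    if v = 0 then 5 else if v = n - 2 then n - 8 else if v = n - 8 then n - 2
    else if n - 6 ≤ v then n - 1 else v + 7
  else
    if v = n - 1 then n - 6 else if v = 1 then 7 else if v = 7 then 1
    else if v ≤ 5 then 0 else v - 7

/-- The orientation at `v`: whether the cyclic order around `v` is `prv`, `chord`, `nxt` (rather than
`prv`, `nxt`, `chord`). It alternates along the path, but is reversed at `1` and `n - 2`. -/
def ChordSecond (n v : ℕ) : Prop := v = 1 ∨ v % 2 = 0 ∧ v ≠ n - 2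

instance (n v : ℕ) : Decidable (ChordSecond n v) := by unfold ChordSecond; infer_instance

/-- The three neighbours of `v` in their cyclic order. -/
def nbr (n v : ℕ) : Fin 3 → ℕ :=
  if ChordSecond n v then ![prv v, chord n v, nxt n v] else ![prv v, nxt n v, chord n v]

/-- `CubicRotation.Turns` for the tube, on natural numbers. -/
def TurnsNat (n u v w : ℕ) : Prop := ∃ i, nbr n v i = u ∧ nbr n v (i + 1) = w

theorem turnsNat_iff {n u v w : ℕ} : TurnsNat n u v w ↔
    if ChordSecond n v then
      u = prv v ∧ w = chord n v ∨ u = chord n v ∧ w = nxt n v ∨ u = nxt n v ∧ w = prv v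
    else u = prv v ∧ w = nxt n v ∨ u = nxt n v ∧ w = chord n v ∨ u = chord n v ∧ w = prv v := by
  unfold TurnsNat nbr
  have h2 : (2 : Fin 3) + 1 = 0 := rfl
  split_ifs <;> simp [Fin.exists_fin_succ, eq_comm, h2]

theorem exists_nbr_iff {n u v : ℕ} :
    (∃ i, nbr n u i = v) ↔ v = prv u ∨ v = chord n u ∨ v = nxt n u := by
  unfold nbr
  split_ifs <;> simp [Fin.exists_fin_succ, eq_comm] <;> tauto

theorem nbr_lt (hn : 10 ≤ n) (heven : Even n) {v : ℕ} (hv : v < n) (i : Fin 3) : nbr n v i < n := by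
  obtain h | h | h := exists_nbr_iff.1 ⟨i, rfl⟩ <;> (rw [h]; rw [Nat.even_iff] at heven)
  · unfold prv; split_ifs <;> omega
  · unfold chord; split_ifs <;> omega
  · unfold nxt; split_ifs <;> omega

theorem nbr_ne (hn : 10 ≤ n) (heven : Even n) {v : ℕ} (i : Fin 3) : nbr n v i ≠ v := by
  obtain h | h | h := exists_nbr_iff.1 ⟨i, rfl⟩ <;> (rw [h]; rw [Nat.even_iff] at heven)
  · unfold prv; split_ifs <;> omega
  · unfold chord; split_ifs <;> omega
  · unfold nxt; split_ifs <;> omega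

theorem nbr_symm (hn : 10 ≤ n) (heven : Even n) {v : ℕ} (hv : v < n) (i : Fin 3) :
    ∃ j, nbr n (nbr n v i) j = v := by
  rw [exists_nbr_iff]
  rw [Nat.even_iff] at heven
  obtain h | h | h := exists_nbr_iff.1 ⟨i, rfl⟩ <;> rw [h]
  · grind (splits := 30) [prv, chord, nxt]
  · grind (splits := 30) [prv, chord, nxt]
  · grind (splits := 30) [prv, chord, nxt]

theorem nbr_injective (hn : 10 ≤ n) (heven : Even n) {v : ℕ} (hv : v < n) :
    Function.Injective (nbr n v) := by
  rw [Nat.even_iff] at heven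
  have h₁ : prv v ≠ nxt n v := by grind [prv, nxt]
  have h₂ : prv v ≠ chord n v := by grind [prv, chord]
  have h₃ : nxt n v ≠ chord n v := by grind [nxt, chord]
  unfold nbr
  split_ifs <;> intro i j <;> fin_cases i <;> fin_cases j <;>
    simp [h₁, h₂, h₃, h₁.symm, h₂.symm, h₃.symm]

/-! ### The faces of the tube -/

/-- The initial vertex of a dart that represents the `j`-th face, `j < n / 2 + 2`. The representatives
are the darts `2 * j → 2 * j + 1` with `2 * j ≤ n - 4`, followed by `1 → 2`, `1 → 0` and `4 → 3`. -/
def repFst (n j : ℕ) : ℕ := if j < n / 2 - 1 then 2 * j else if j ≤ n / 2 then 1 else 4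

/-- The end of the dart that represents the `j`-th face; see `repFst`. -/
def repSnd (n j : ℕ) : ℕ :=
  if j < n / 2 - 1 then 2 * j + 1 else if j < n / 2 then 2 else if j = n / 2 then 0 else 3

/-- `w` is the boundary cycle of the `j`-th face: it consists of distinct vertices, follows the turns,
starts with the representing dart of the face, and passes through no other representing dart. -/
structure IsFaceWalk (n j : ℕ) {k : ℕ} [NeZero k] (w : Fin k → ℕ) : Prop where
  lt : ∀ i, w i < n
  inj : Function.Injective w
  turns : ∀ i, TurnsNat n (w i) (w (i + 1)) (w (i + 2))
  fst : w 0 = repFst n j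
  snd : w 1 = repSnd n j
  unique : ∀ j' < n / 2 + 2, ∀ i, repFst n j' = w i → repSnd n j' = w (i + 1) → j' = j

set_option maxHeartbeats 2000000 in
theorem exists_isFaceWalk (hn : 10 ≤ n) (heven : Even n) {j : ℕ} (hj : j < n / 2 + 2) :
    (∃ w : Fin 4 → ℕ, IsFaceWalk n j w) ∨ (∃ w : Fin 5 → ℕ, IsFaceWalk n j w) ∨
      ∃ w : Fin 6 → ℕ, IsFaceWalk n j w := by
  rw [Nat.even_iff] at heven
  have hcases : j = 0 ∨ (1 ≤ j ∧ j + 6 ≤ n / 2) ∨ (j = n / 2 - 5 ∧ n ≠ 10) ∨ j = n / 2 - 4 ∨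
      j = n / 2 - 3 ∨ j = n / 2 - 2 ∨ (j = n / 2 - 1 ∧ n = 10) ∨ (j = n / 2 - 1 ∧ n ≠ 10) ∨
      j = n / 2 ∨ j = n / 2 + 1 := by omega
  obtain rfl | ⟨h₁, h₂⟩ | ⟨rfl, h₁⟩ | rfl | rfl | rfl | ⟨rfl, rfl⟩ | ⟨rfl, h₁⟩ | rfl | rfl := hcases
  -- The hexagons `1 ≤ j ≤ n / 2 - 6` form the body of the tube, the other faces its ends. For
  -- `n = 10` the value `n / 2 - 5` is the face `0`, and the face of `1 → 2`, otherwise a pentagon,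
  -- loses the vertex `9`.
  on_goal 1 => refine .inr (.inl ⟨![0, 1, 7, 6, 5], ?_⟩)
  on_goal 2 =>
    refine .inr (.inr ⟨![2 * j, 2 * j + 1, 2 * j + 2, 2 * j + 9, 2 * j + 8, 2 * j + 7], ?_⟩)
  on_goal 3 => refine .inr (.inl ⟨![n - 10, n - 9, n - 8, n - 2, n - 3], ?_⟩)
  on_goal 4 => refine .inr (.inl ⟨![n - 8, n - 7, n - 6, n - 1, n - 2], ?_⟩)
  on_goal 5 => refine .inl ⟨![n - 6, n - 5, n - 4, n - 1], ?_⟩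
  on_goal 6 => refine .inl ⟨![n - 4, n - 3, n - 2, n - 1], ?_⟩
  on_goal 7 => refine .inl ⟨![1, 2, 8, 7], ?_⟩
  on_goal 8 => refine .inr (.inl ⟨![1, 2, 9, 8, 7], ?_⟩)
  on_goal 9 => refine .inl ⟨![1, 0, 3, 2], ?_⟩
  on_goal 10 => refine .inl ⟨![4, 3, 0, 5], ?_⟩
  all_goals
    constructor
    · simp [Fin.forall_fin_succ] <;> omega
    · intro a b h
      fin_cases a <;> fin_cases b <;> simp at h ⊢ <;> omega
    · intro i
      rw [turnsNat_iff]
      fin_cases i <;> simp <;> grind (splits := 30) [prv, nxt, chord, ChordSecond]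
    · rw [repFst]
      split_ifs <;> simp <;> omega
    · rw [repSnd]
      split_ifs <;> simp <;> omega
    · simp [Fin.forall_fin_succ]
      grind (splits := 30) [repFst, repSnd]

/-! ### Every dart lies on a listed face -/

theorem prv_lt (hn : 10 ≤ n) {v : ℕ} (hv : v < n) : prv v < n := by grind [prv]

theorem nxt_lt (hn : 10 ≤ n) {v : ℕ} (hv : v < n) : nxt n v < n := by grind [nxt]

theorem chord_lt (hn : 10 ≤ n) (heven : n % 2 = 0) {v : ℕ} (hv : v < n) : chord n v < n := by
  grind (splits := 20) [chord]

theorem chord_chord_of_odd (hn : 10 ≤ n) (heven : n % 2 = 0) {v : ℕ} (hv : v < n)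
    (hodd : v % 2 = 1) (h₁ : v ≠ 1) (h₃ : v ≠ 3) (h₇ : v ≠ 7) :
    chord n v % 2 = 0 ∧ chord n v < n - 2 ∧ chord n (chord n v) = v := by
  grind (splits := 20) [chord]

/-- A property of darts that holds for the representatives of the faces and propagates along turns
holds for all darts. Hence every dart lies on a represented face. -/
theorem dart_induction {P : ℕ → ℕ → Prop} (hn : 10 ≤ n) (heven : Even n)
    (hrep : ∀ j < n / 2 + 2, P (repFst n j) (repSnd n j))
    (hstep : ∀ u v w, u < n → v < n → TurnsNat n u v w → P u v → P v w) {u v : ℕ} (hu : u < n)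
    (h : ∃ i, nbr n u i = v) : P u v := by
  rw [Nat.even_iff] at heven
  -- `pc` treats the boundary walk that enters `v` from `prv v` and leaves it towards `chord n v`;
  -- likewise for the other five turns.
  have pc (v : ℕ) (hv : v < n) (hc : ChordSecond n v) (h : P (prv v) v) : P v (chord n v) :=
    hstep _ _ _ (prv_lt hn hv) hv (turnsNat_iff.2 (by simp [hc])) h
  have np (v : ℕ) (hv : v < n) (hc : ChordSecond n v) (h : P (nxt n v) v) : P v (prv v) :=
    hstep _ _ _ (nxt_lt hn hv) hv (turnsNat_iff.2 (by simp [hc])) h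
  have pn (v : ℕ) (hv : v < n) (hc : ¬ ChordSecond n v) (h : P (prv v) v) : P v (nxt n v) :=
    hstep _ _ _ (prv_lt hn hv) hv (turnsNat_iff.2 (by simp [hc])) h
  have nc (v : ℕ) (hv : v < n) (hc : ¬ ChordSecond n v) (h : P (nxt n v) v) : P v (chord n v) :=
    hstep _ _ _ (nxt_lt hn hv) hv (turnsNat_iff.2 (by simp [hc])) h
  have cp (v : ℕ) (hv : v < n) (hc : ¬ ChordSecond n v) (h : P (chord n v) v) : P v (prv v) :=
    hstep _ _ _ (chord_lt hn heven hv) hv (turnsNat_iff.2 (by simp [hc])) h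
  clear hstep
  have hprv (v : ℕ) (hv : v ≠ 0) : prv v = v - 1 := if_neg hv
  have hnxt (v : ℕ) (hv : v ≠ n - 1) : nxt n v = v + 1 := if_neg hv
  have r0 (u : ℕ) (hu : u < n - 2) (h2 : u % 2 = 0) : P u (u + 1) := by
    have := hrep (u / 2) (by omega)
    simp only [repFst, repSnd, show u / 2 < n / 2 - 1 by omega, if_true,
      show 2 * (u / 2) = u by omega] at this
    exact this
  have r1 : P 1 2 := by
    have := hrep (n / 2 - 1) (by omega)
    grind [repFst, repSnd]
  have r2 : P 1 0 := by
    have := hrep (n / 2) (by omega)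
    grind [repFst, repSnd]
  have r3 : P 4 3 := by
    have := hrep (n / 2 + 1) (by omega)
    grind [repFst, repSnd]
  clear hrep
  have hnext (u : ℕ) (hu : u < n - 1) : P u (u + 1) := by
    induction u with
    | zero => exact r0 0 (by omega) rfl
    | succ u ih =>
      by_cases h1 : u = 0
      · rw [h1]; exact r1
      by_cases h2 : u + 1 < n - 2 ∧ (u + 1) % 2 = 0
      · exact r0 _ h2.1 h2.2
      have := pn (u + 1) (by omega) (by grind [ChordSecond])
        (by rw [hprv _ (by omega)]; exact ih (by omega))
      rwa [hnxt _ (by omega)] at this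
  have hprv' (v : ℕ) (h0 : v ≠ 0) (hv : v < n) : P (prv v) v := by
    have := hnext (v - 1) (by omega)
    rwa [← hprv v h0, hprv v h0, show v - 1 + 1 = v by omega, ← hprv v h0] at this
  have hlast : P (n - 1) (nxt n (n - 1)) :=
    pn _ (by omega) (by grind [ChordSecond]) (hprv' _ (by omega) (by omega))
  have p03 : P 0 3 :=
    np 0 (by omega) (by grind [ChordSecond]) (by rw [hnxt 0 (by omega)]; exact r2)
  have p05 : P 0 (chord n 0) := by
    refine pc 0 (by omega) (by grind [ChordSecond]) ?_
    have := nc 3 (by omega) (by grind [ChordSecond]) (by rw [hnxt 3 (by omega)]; exact r3)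
    rwa [show chord n 3 = 0 by grind [chord]] at this
  have p17 : P 1 (chord n 1) :=
    pc 1 (by omega) (by grind [ChordSecond]) (hprv' 1 (by omega) (by omega))
  have hchord (u : ℕ) (hu : u < n - 2) (h2 : u % 2 = 0) : P u (chord n u) := by
    by_cases h0 : u = 0
    · rw [h0]; exact p05
    · exact pc u (by omega) (by grind [ChordSecond]) (hprv' u h0 (by omega))
  have hback (u : ℕ) (hu : u < n) (h2 : u % 2 = 1) : P u (prv u) := by
    by_cases h1 : u = 1
    · rw [h1]; exact r2
    refine cp u hu (by grind [ChordSecond]) ?_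
    by_cases h3 : u = 3
    · rw [show chord n u = 0 by grind [chord], h3]; exact p03
    by_cases h7 : u = 7
    · rw [show chord n 1 = 7 by grind [chord]] at p17
      rw [show chord n u = 1 by grind [chord], h7]; exact p17
    obtain ⟨ha, hb, hc⟩ := chord_chord_of_odd hn heven hu h2 h1 h3 h7
    have := hchord _ hb ha
    rwa [hc] at this
  have hback' (u : ℕ) (hu : u < n) (h2 : u % 2 = 0) : P u (prv u) := by
    by_cases hu2 : u = n - 2
    · refine cp u hu (by grind [ChordSecond]) ?_
      have := hchord (n - 8) (by omega) (by omega)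
      rwa [show chord n (n - 8) = u by grind [chord], show n - 8 = chord n u by grind [chord]]
        at this
    · refine np u hu (by grind [ChordSecond]) ?_
      have := hback (u + 1) (by omega) (by omega)
      rwa [hprv _ (by omega), Nat.add_sub_cancel, ← hnxt u (by omega)] at this
  obtain rfl | rfl | rfl := exists_nbr_iff.1 h
  · rcases Nat.mod_two_eq_zero_or_one u with h' | h'
    · exact hback' u hu h'
    · exact hback u hu h'
  · by_cases h1 : u = 1
    · rw [h1]; exact p17
    rcases Nat.mod_two_eq_zero_or_one u with h' | h'
    · by_cases hu2 : u = n - 2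
      · refine nc u hu (by grind [ChordSecond]) ?_
        have := hback (u + 1) (by omega) (by omega)
        rwa [hprv _ (by omega), Nat.add_sub_cancel, ← hnxt u (by omega)] at this
      · exact hchord u (by omega) h'
    · refine nc u hu (by grind [ChordSecond]) ?_
      by_cases hu1 : u = n - 1
      · have := hchord (n - 4) (by omega) (by omega)
        rwa [show chord n (n - 4) = u by grind [chord], show n - 4 = nxt n u by grind [nxt]] at this
      · have := hback' (u + 1) (by omega) (by omega)
        rwa [hprv _ (by omega), Nat.add_sub_cancel, ← hnxt u hu1] at this
  · by_cases hu1 : u = n - 1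
    · rw [hu1]; exact hlast
    · rw [hnxt u hu1]
      exact hnext u (by omega)

/-! ### The tube as a plane graph -/

/-- The tube on `n` vertices, with its embedding. -/
def tubeRotation (n : ℕ) (hn : 10 ≤ n) (heven : Even n) : CubicRotation (Fin n) where
  nb v i := ⟨nbr n v i, nbr_lt hn heven v.2 i⟩
  inj v _ _ h := nbr_injective hn heven v.2 (congrArg Fin.val h)
  ne v i h := nbr_ne hn heven i (congrArg Fin.val h)
  symm v i := by
    obtain ⟨j, hj⟩ := nbr_symm hn heven v.2 i
    exact ⟨j, Fin.ext hj⟩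

section

variable (hn : 10 ≤ n) (heven : Even n)

local notation "R" => tubeRotation n hn heven

theorem tube_adj_iff {u v : Fin n} :
    (R).graph.Adj u v ↔ (v : ℕ) = prv u ∨ (v : ℕ) = chord n u ∨ (v : ℕ) = nxt n u := by
  rw [← exists_nbr_iff]
  exact exists_congr fun _ => Fin.ext_iff

theorem tube_turns_iff {u v w : Fin n} : (R).Turns u v w ↔ TurnsNat n u v w :=
  exists_congr fun _ => and_congr Fin.ext_iff Fin.ext_iff

theorem tube_connected : (R).graph.Connected := by
  have h (k : ℕ) (hk : k < n) : (R).graph.Reachable ⟨0, by omega⟩ ⟨k, hk⟩ := by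
    induction k with
    | zero => exact .refl _
    | succ k ih =>
      refine (ih (by omega)).trans (SimpleGraph.Adj.reachable ?_)
      rw [tube_adj_iff]
      exact .inr (.inr (by simp only [nxt]; rw [if_neg (by omega)]))
  have : Nonempty (Fin n) := ⟨⟨0, by omega⟩⟩
  exact ⟨fun u v => (h u u.2).symm.trans (h v v.2)⟩

theorem exists_faceDart {j : ℕ} (hj : j < n / 2 + 2) :
    ∃ d : (R).graph.Dart, (d.fst : ℕ) = repFst n j ∧ (d.snd : ℕ) = repSnd n j := by
  have key {k : ℕ} [NeZero k] {w : Fin k → ℕ} (h : IsFaceWalk n j w) :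
      ∃ d : (R).graph.Dart, (d.fst : ℕ) = repFst n j ∧ (d.snd : ℕ) = repSnd n j := by
    obtain ⟨i, hi, -⟩ := (tube_turns_iff hn heven (u := ⟨w 0, h.lt _⟩) (v := ⟨w (0 + 1), h.lt _⟩)
      (w := ⟨w (0 + 2), h.lt _⟩)).2 (h.turns 0)
    have ha := ((R).adj_nb ⟨w (0 + 1), h.lt _⟩ i).symm
    rw [hi] at ha
    exact ⟨⟨(_, _), ha⟩, h.fst, (congrArg w (zero_add 1)).trans h.snd⟩
  obtain ⟨w, h⟩ | ⟨w, h⟩ | ⟨w, h⟩ := exists_isFaceWalk hn heven hj <;> exact key h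

/-- The dart representing the `j`-th face. -/
noncomputable def faceDart (j : Fin (n / 2 + 2)) : (R).graph.Dart :=
  (exists_faceDart hn heven j.2).choose

theorem faceDart_fst (j : Fin (n / 2 + 2)) : ((faceDart hn heven j).fst : ℕ) = repFst n j :=
  (exists_faceDart hn heven j.2).choose_spec.1

theorem faceDart_snd (j : Fin (n / 2 + 2)) : ((faceDart hn heven j).snd : ℕ) = repSnd n j :=
  (exists_faceDart hn heven j.2).choose_spec.2

theorem exists_sameCycle_faceDart (d : (R).graph.Dart) :
    ∃ j, (facePerm (R).rot).SameCycle (faceDart hn heven j) d := by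
  let P (u v : ℕ) : Prop := ∀ e : (R).graph.Dart, (e.fst : ℕ) = u → (e.snd : ℕ) = v →
    ∃ j, (facePerm (R).rot).SameCycle (faceDart hn heven j) e
  refine dart_induction (P := P) hn heven ?_ ?_ d.fst.2 (v := d.snd) ?_ d rfl rfl
  · intro j hj e h₁ h₂
    refine ⟨⟨j, hj⟩, ?_⟩
    have : faceDart hn heven ⟨j, hj⟩ = e := SimpleGraph.Dart.ext _ _ <| Prod.ext
      (Fin.ext ((faceDart_fst ..).trans h₁.symm)) (Fin.ext ((faceDart_snd ..).trans h₂.symm))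
    exact this ▸ .refl _ _
  · intro u v w hu hv hT hP e h₁ h₂
    subst h₁ h₂
    have hT' := (tube_turns_iff hn heven (u := ⟨u, hu⟩)).2 hT
    obtain ⟨i, hi, -⟩ := id hT'
    have ha := ((R).adj_nb e.fst i).symm
    rw [hi] at ha
    obtain ⟨j, hj⟩ := hP ⟨(_, _), ha⟩ rfl rfl
    have he := (R).facePerm_of_turns (d := ⟨(_, _), ha⟩) hT'
    refine ⟨j, ?_⟩
    have : facePerm (R).rot ⟨(_, _), ha⟩ = e := SimpleGraph.Dart.ext _ _ (Prod.ext he.1 he.2)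
    exact this ▸ Equiv.Perm.sameCycle_apply_right.2 hj
  · obtain ⟨i, hi⟩ := d.adj
    exact ⟨i, congrArg Fin.val hi⟩

theorem IsFaceWalk.turns_fin {j k : ℕ} [NeZero k] {w : Fin k → ℕ} (h : IsFaceWalk n j w)
    (i : Fin k) : (R).Turns ⟨w i, h.lt i⟩ ⟨w (i + 1), h.lt _⟩ ⟨w (i + 2), h.lt _⟩ :=
  (tube_turns_iff ..).2 (h.turns i)

theorem faceDart_injective {j j' : Fin (n / 2 + 2)}
    (h : (facePerm (R).rot).SameCycle (faceDart hn heven j) (faceDart hn heven j')) : j = j' := by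
  have key {k : ℕ} [NeZero k] {w : Fin k → ℕ} (hw : IsFaceWalk n j w) : j = j' := by
    obtain ⟨i, h₁, h₂⟩ := (R).exists_of_sameCycle (w := fun i => ⟨w i, hw.lt i⟩)
      (hw.turns_fin hn heven) (Fin.ext ((faceDart_fst ..).trans hw.fst.symm))
      (Fin.ext ((faceDart_snd ..).trans hw.snd.symm)) h
    rw [Fin.ext_iff, faceDart_fst] at h₁
    rw [Fin.ext_iff, faceDart_snd] at h₂
    exact Fin.ext (hw.unique j' j'.2 i h₁ h₂).symm
  obtain ⟨w, h⟩ | ⟨w, h⟩ | ⟨w, h⟩ := exists_isFaceWalk hn heven j.2 <;> exact key h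

/-- The `n / 2 + 2` represented faces are all the faces, and they are distinct. -/
theorem card_face : Nat.card (Face (R).rot) = n / 2 + 2 := by
  rw [← Nat.card_fin (n / 2 + 2)]
  refine (Nat.card_eq_of_bijective (fun j => (Quotient.mk _ (faceDart hn heven j) :
    Quotient (Equiv.Perm.SameCycle.setoid (facePerm (R).rot)))) ⟨fun j j' h => ?_, fun f => ?_⟩).symm
  · exact faceDart_injective hn heven (Quotient.exact h)
  · induction f using Quotient.inductionOn with
    | h d =>
      obtain ⟨j, hj⟩ := exists_sameCycle_faceDart hn heven d
      exact ⟨j, Quotient.sound hj⟩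

/-- The tube as a plane graph. -/
noncomputable def tubeEmbedding : PlaneEmbedding (R).graph where
  connected := tube_connected hn heven
  rot := (R).rot
  rot_fst _ := rfl
  rot_sameCycle := (R).rot_sameCycle
  euler := by
    have h := (R).two_mul_card_edgeSet
    have := Nat.even_iff.1 heven
    rw [Nat.card_fin] at h
    rw [card_face, Nat.card_fin]
    omega

theorem faceDart_faceIsGon {j : Fin (n / 2 + 2)} {k : ℕ} [NeZero k] {w : Fin k → ℕ}
    (hw : IsFaceWalk n j w) : (tubeEmbedding hn heven).FaceIsGon (faceDart hn heven j) k :=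
  (R).facePerm_gon (w := fun i => ⟨w i, hw.lt i⟩) (fun _ _ h => hw.inj (congrArg Fin.val h))
    (hw.turns_fin hn heven) (Fin.ext ((faceDart_fst ..).trans hw.fst.symm))
    (Fin.ext ((faceDart_snd ..).trans hw.snd.symm))

theorem is456Fullerene_tube : Is456Fullerene (R).graph := by
  refine ⟨(R).ncard_neighborSet, tubeEmbedding hn heven, fun d => ?_⟩
  obtain ⟨j, hj⟩ := exists_sameCycle_faceDart hn heven d
  obtain ⟨w, h⟩ | ⟨w, h⟩ | ⟨w, h⟩ := exists_isFaceWalk hn heven j.2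
  · exact .inl ((faceDart_faceIsGon hn heven h).of_sameCycle (by norm_num) hj)
  · exact .inr (.inl ((faceDart_faceIsGon hn heven h).of_sameCycle (by norm_num) hj))
  · exact .inr (.inr ((faceDart_faceIsGon hn heven h).of_sameCycle (by norm_num) hj))

/-! ### A matching of size two that does not extend -/

/-- No perfect matching `f` of the tube contains both the edges `{1, 7}` and `{n - 2, n - 1}`: such a
matching would send the even vertices injectively to the odd ones, and miss `1`. -/
theorem no_perfect_pairing (hn : 10 ≤ n) (heven : Even n) {f : ℕ → ℕ}
    (hlt : ∀ v < n, f v < n) (hinv : ∀ v < n, f (f v) = v)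
    (hadj : ∀ v < n, f v = prv v ∨ f v = chord n v ∨ f v = nxt n v) (h₁ : f 1 = 7)
    (h₂ : f (n - 2) = n - 1) : False := by
  rw [Nat.even_iff] at heven
  have hodd (v : ℕ) (hv : v < n) (h0 : v % 2 = 0) : f v % 2 = 1 := by
    -- The only edge between two even vertices joins `n - 8` to `n - 2`, which is matched to `n - 1`.
    have h8 : v = n - 8 → f v ≠ n - 2 := by
      intro h h'
      have := hinv v hv
      rw [h', h₂] at this
      omega
    have := hadj v hv
    by_cases hv2 : v = n - 2
    · rw [hv2, h₂]; omega
    · clear hadj hinv hlt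
      grind (splits := 30) [prv, chord, nxt]
  -- `f` on even vertices, with the `k`-th even vertex and the `k`-th odd vertex both encoded as `k`;
  -- the odd vertex `1` has code `0`.
  let g (k : Fin (n / 2)) : Fin (n / 2) := ⟨f (2 * k) / 2, by
    have := hlt (2 * k) (by omega)
    omega⟩
  have hg : Function.Injective g := by
    intro a b hab
    have h : f (2 * a) / 2 = f (2 * b) / 2 := congrArg Fin.val hab
    have ha := hodd (2 * a) (by omega) (by omega)
    have hb := hodd (2 * b) (by omega) (by omega)
    have h' : f (2 * a) = f (2 * b) := by omega
    have := (hinv (2 * a) (by omega)).symm.trans ((congrArg f h').trans (hinv (2 * b) (by omega)))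
    exact Fin.ext (by omega)
  obtain ⟨a, ha⟩ := (Finite.injective_iff_surjective.1 hg) ⟨0, by omega⟩
  have ha' : f (2 * a) / 2 = 0 := congrArg Fin.val ha
  have ho := hodd (2 * a) (by omega) (by omega)
  have h := hinv (2 * a) (by omega)
  rw [show f (2 * a) = 1 by omega, h₁] at h
  omega

theorem not_isExtendable_tube : ¬ IsExtendable (R).graph 2 := by
  rintro ⟨-, -, -, h⟩
  have hne := Nat.even_iff.1 heven
  have a₁ : (R).graph.Adj ⟨1, by omega⟩ ⟨7, by omega⟩ := by
    rw [tube_adj_iff]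
    grind [chord]
  have a₂ : (R).graph.Adj ⟨n - 2, by omega⟩ ⟨n - 1, by omega⟩ := by
    rw [tube_adj_iff]
    grind [nxt]
  obtain ⟨N, ⟨hN, hspan⟩, hle⟩ := h ((R).graph.subgraphOfAdj a₁ ⊔ (R).graph.subgraphOfAdj a₂) (by
    refine (SimpleGraph.Subgraph.IsMatching.subgraphOfAdj a₁).sup
      (SimpleGraph.Subgraph.IsMatching.subgraphOfAdj a₂) ?_
    rw [SimpleGraph.support_subgraphOfAdj, SimpleGraph.support_subgraphOfAdj]
    simp
    omega) (by
    rw [SimpleGraph.Subgraph.edgeSet_sup, SimpleGraph.edgeSet_subgraphOfAdj,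
      SimpleGraph.edgeSet_subgraphOfAdj, Set.singleton_union, Set.ncard_pair]
    simp
    omega)
  have hex (v : Fin n) : ∃! w, N.Adj v w := hN (hspan v)
  choose p hp hpu using fun v => hex v
  have hpp (v : Fin n) : p (p v) = v := (hpu (p v) v (hp v).symm).symm
  have e₁ : p ⟨1, by omega⟩ = ⟨7, by omega⟩ := (hpu _ _ (hle.2 (by simp))).symm
  have e₂ : p ⟨n - 2, by omega⟩ = ⟨n - 1, by omega⟩ := (hpu _ _ (hle.2 (by simp))).symm
  refine no_perfect_pairing hn heven (f := fun v => if h : v < n then p ⟨v, h⟩ else 0)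
    (fun v hv => ?_) (fun v hv => ?_) (fun v hv => ?_) ?_ ?_
  · simp [hv]
  · simp [hv, hpp]
  · simp only [hv, dif_pos]
    exact (tube_adj_iff hn heven).1 (hp ⟨v, hv⟩).adj_sub
  · simp only [show 1 < n by omega, dif_pos, e₁]
  · simp only [show n - 2 < n by omega, dif_pos, e₂]

end

end Fullerene

theorem corollary3p6 (n : ℕ) (hn : 10 ≤ n) (heven : Even n) :
    ∃ G : SimpleGraph (Fin n), Fullerene.Is456Fullerene G ∧ ¬ Fullerene.IsExtendable G 2 :=
  ⟨_, Fullerene.is456Fullerene_tube hn heven, Fullerene.not_isExtendable_tube hn heven⟩
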